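/- Let $R$ be a finite commutative principal ideal ring with identity, and let $\mathfrak m_1,\dots,\mathfrak m_k$ be its distinct maximal ideals. For each $i$ let $t_i\ge 1$ be the index of stability of $\mathfrak m_i$, i.e. the smallest $e\ge 1$ such that $\mathfrak m_i^{e}=\mathfrak m_i^{e+1}=\cdots$. Put $R_i=R/\mathfrak m_i^{t_i}$, so that $R\cong\prod_{i=1}^k R_i$ canonically; each $R_i$ is a local ring, and $q_i$ denotes the number of elements of its residue field. Let $n$ be a non-negative integer with $\gcd(n,q_i)=1$ for all $1\le i\le k$. For each $i$ let $C_i\subseteq R_i^n$ be a linear code (an $R_i$-submodule), and let $$C=\mathrm{CRT}(C_1,\dots,C_k)=\{u\in R^n : \Psi_i(u)\in C_i \text{ for } i=1,\dots,k\},$$ where $\Psi_i:R^n\to R_i^n$ is the coordinatewise reduction modulo $\mathfrak m_i^{t_i}$. Suppose that $C$ is cyclic, i.e. $(c_{n-1},c_0,\dots,c_{n-2})\in C$ whenever $(c_0,\dots,c_{n-1})\in C$. If there exists $i\in\{1,\dots,k\}$ such that $q_i$ is odd and $C_i$ is a free $R_i$-module, then $C$ is not self-dual, i.e. $C\neq C^\perp$,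 where $C^\perp=\{u\in R^n : \sum_j u_jv_j=0 \text{ for all } v\in C\}$. -/

import Mathlib

namespace RingCode

section LocalComponents

variable {R : Type*} [CommRing R]

/-- The index of stability of an ideal `I`: the smallest `e ≥ 1` with
`I ^ e = I ^ (e + 1) = I ^ (e + 2) = ⋯`. -/
noncomputable def stabilityIndex (I : Ideal R) : ℕ :=
  sInf {e : ℕ | 1 ≤ e ∧ ∀ j, e ≤ j → I ^ j = I ^ e}

/-- In a finite ring the index of stability is attained. -/
theorem stabilityIndex_mem [Finite R] (I : Ideal R) :
    1 ≤ stabilityIndex I ∧ ∀ j, stabilityIndex I ≤ j → I ^ j = I ^ stabilityIndex I := by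
  have hne : {e : ℕ | 1 ≤ e ∧ ∀ j, e ≤ j → I ^ j = I ^ e}.Nonempty := by
    obtain ⟨N, hN⟩ := WellFoundedGT.monotone_chain_condition
      (⟨fun j => OrderDual.toDual (I ^ j), fun a b hab => Ideal.pow_le_pow_right hab⟩ :
        ℕ →o (Ideal R)ᵒᵈ)
    have hN' : ∀ j, N ≤ j → I ^ N = I ^ j := fun j hj => hN j hj
    exact ⟨N + 1, by omega, fun j hj => (hN' j (by omega)).symm.trans (hN' (N + 1) (by omega))⟩
  exact Nat.sInf_mem hne

/-- The local component `R / 𝔪 ^ t` of `R` at a maximal ideal `𝔪`, where `t` is the index of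
stability of `𝔪`. -/
abbrev LocalComponent (m : MaximalSpectrum R) : Type _ :=
  R ⧸ m.asIdeal ^ stabilityIndex m.asIdeal

instance [Finite R] (m : MaximalSpectrum R) : IsLocalRing (LocalComponent m) := by
  have h1 := (stabilityIndex_mem m.asIdeal).1
  have hm := m.isMaximal
  have : Nontrivial (LocalComponent m) := Ideal.Quotient.nontrivial_iff.mpr fun h =>
    hm.ne_top (top_le_iff.mp (h ▸ Ideal.pow_le_self (by omega)))
  refine IsLocalRing.of_unique_max_ideal
    ⟨m.asIdeal.map (Ideal.Quotient.mk _), ?_, fun J hJ => ?_⟩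
  · refine (Ideal.map_eq_top_or_isMaximal_of_surjective _
      Ideal.Quotient.mk_surjective hm).resolve_left fun h => hm.ne_top ?_
    have h2 := congrArg (Ideal.comap (Ideal.Quotient.mk
      (m.asIdeal ^ stabilityIndex m.asIdeal))) h
    rwa [Ideal.comap_map_of_surjective' _ Ideal.Quotient.mk_surjective, Ideal.mk_ker,
      Ideal.comap_top, sup_eq_left.mpr (Ideal.pow_le_self (by omega))] at h2
  · have hle : m.asIdeal ≤ J.comap (Ideal.Quotient.mk _) := by
      have := Ideal.comap_isPrime (Ideal.Quotient.mk
        (m.asIdeal ^ stabilityIndex m.asIdeal)) J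
      refine this.le_of_pow_le (n := stabilityIndex m.asIdeal) fun x hx => ?_
      rw [Ideal.mem_comap, Ideal.Quotient.eq_zero_iff_mem.mpr hx]
      exact J.zero_mem
    have hmax : (m.asIdeal.map (Ideal.Quotient.mk _)) ≤ J := Ideal.map_le_iff_le_comap.mpr hle
    have heq : m.asIdeal = J.comap (Ideal.Quotient.mk _) :=
      hm.eq_of_le (Ideal.comap_ne_top _ hJ.ne_top) hle
    refine le_antisymm ?_ hmax
    have hJ' := Ideal.map_comap_of_surjective (Ideal.Quotient.mk
      (m.asIdeal ^ stabilityIndex m.asIdeal)) Ideal.Quotient.mk_surjective J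
    exact hJ'.symm.le.trans (Ideal.map_mono heq.symm.le)

/-- The number of elements of the residue field of the local component at `m`. -/
noncomputable def residueCard [Finite R] (m : MaximalSpectrum R) : ℕ :=
  Nat.card (IsLocalRing.ResidueField (LocalComponent m))

end LocalComponents

section Codes

variable {R : Type*} [CommRing R] {n : ℕ}

/-- The dual code `{u | [u, v] = 0 for all v ∈ C}` for the standard inner product
`[u, v] = ∑ j, u j * v j`. -/
def dualCode (C : Submodule R (Fin n → R)) : Submodule R (Fin n → R) where
  carrier := {u | ∀ v ∈ C, ∑ j, u j * v j = 0}
  zero_mem' := fun v _ => by simp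
  add_mem' := fun {a b} ha hb v hv => by
    have h1 := ha v hv
    have h2 := hb v hv
    simp [add_mul, Finset.sum_add_distrib, h1, h2]
  smul_mem' := fun r a ha v hv => by
    have h1 := ha v hv
    simp [mul_assoc, ← Finset.mul_sum, h1]

/-- A linear code is self-dual if it equals its dual code. -/
def IsSelfDual (C : Submodule R (Fin n → R)) : Prop :=
  C = dualCode C

/-- A linear code is cyclic if `(c_{n-1}, c_0, …, c_{n-2})` is a codeword
whenever `(c_0, c_1, …, c_{n-1})` is. -/
def IsCyclicCode (C : Submodule R (Fin n → R)) : Prop :=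
  ∀ c ∈ C, (fun j => c ((finRotate n).symm j)) ∈ C

/-- The coordinatewise canonical projection `R ^ n → (R / 𝔪 ^ t) ^ n`. -/
noncomputable def projection (m : MaximalSpectrum R) (u : Fin n → R) : Fin n → LocalComponent m :=
  fun j => Ideal.Quotient.mk _ (u j)

/-- The Chinese product `CRT(C_1, …, C_k)` of codes `C_i` over the local components at
`m_1, …, m_k`: all words over `R` whose `i`-th projection lies in `C_i` for every `i`. -/
noncomputable def chineseProduct {k : ℕ} (m : Fin k → MaximalSpectrum R)
    (C : ∀ i, Submodule (LocalComponent (m i)) (Fin n → LocalComponent (m i))) :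
    Submodule R (Fin n → R) where
  carrier := {u | ∀ i, projection (m i) u ∈ C i}
  zero_mem' := fun i => (C i).zero_mem
  add_mem' := fun {_ _} ha hb i => (C i).add_mem (ha i) (hb i)
  smul_mem' := fun r _ ha i => (C i).smul_mem (Ideal.Quotient.mk _ r) (ha i)

end Codes

end RingCode

/-!
The obstruction is located at the constant words. Let `S` be a local component at which the
component `D` of the code is free. Cyclicity and self-duality pass from the Chinese product to its
components (`chineseProduct_component_cyclic`, `chineseProduct_component_isSelfDual`), because words
can be lifted from one component with zeros in all the others, and because `⋂ i, 𝔪 i ^ t i = 0`.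
Coprimality of the length `n` with the residue cardinality makes `n` a unit of `S`, so averaging
over the cyclic shifts is a projection of `S ^ n` onto the line of constant words.

Let `I` be the ideal of all `a` such that the constant word `a` lies in `D`. The averaging map
retracts `D` onto `I`, so `I` is projective, hence free over the local ring `S`. Since `D` is
self-orthogonal and `n` is a unit, every element of `I` squares to zero; a member of
a basis of `I` would be a non-zero element annihilated only by `0` which squares to zero, so the basis is empty and `I = 0`. Then all
words of `D` have coordinate sum zero, so the word `1` is orthogonal to `D`; by self-duality
`1 ∈ I`, which is absurd. This is `not_isSelfDual_of_free_of_isCyclicCode`.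
-/

namespace RingCode

section LocalRing

variable {S : Type*} [CommRing S] {n : ℕ}

/-- The ideal of all `a` such that the constant word `(a, …, a)` is a codeword. -/
def constantIdeal (D : Submodule S (Fin n → S)) : Ideal S where
  carrier := {a | (fun _ => a) ∈ D}
  zero_mem' := D.zero_mem
  add_mem' := fun ha hb => D.add_mem ha hb
  smul_mem' := fun r _ ha => D.smul_mem r ha

theorem mem_constantIdeal {D : Submodule S (Fin n → S)} {a : S} :
    a ∈ constantIdeal D ↔ (fun _ => a) ∈ D := Iff.rfl

theorem IsCyclicCode.iterate {D : Submodule S (Fin n → S)} (hD : IsCyclicCode D)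
    {c : Fin n → S} (hc : c ∈ D) (i : ℕ) :
    (fun j => c (((finRotate n).symm ^ i) j)) ∈ D := by
  induction i with
  | zero => simpa using hc
  | succ i ih =>
    have h := hD _ ih
    simpa only [pow_succ, Equiv.Perm.mul_apply] using h

open Fin.CommRing in
/-- The sum of all cyclic shifts of a word is constant, equal to the sum of the coordinates. -/
theorem sum_mem_constantIdeal {D : Submodule S (Fin n → S)} (hD : IsCyclicCode D)
    {c : Fin n → S} (hc : c ∈ D) : ∑ j, c j ∈ constantIdeal D := by
  rcases n with _ | n
  · simp
  rw [mem_constantIdeal]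
  have key : ∀ (i : ℕ) (j : Fin (n + 1)),
      ((finRotate (n + 1)).symm ^ i) j = j - (i : Fin (n + 1)) := by
    intro i
    induction i with
    | zero => simp
    | succ i ih =>
      intro j
      rw [pow_succ', Equiv.Perm.mul_apply, ih, Equiv.symm_apply_eq, finRotate_apply]
      push_cast
      ring
  have h := D.sum_mem (t := Finset.univ)
    (f := fun i : Fin (n + 1) => fun j => c (((finRotate (n + 1)).symm ^ (i : ℕ)) j))
    fun i _ => hD.iterate hc i
  convert h using 1
  ext j
  simp only [Finset.sum_apply, key, Fin.cast_val_eq_self]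
  exact (Equiv.sum_comp (Equiv.subLeft j) c).symm

/-- The constant words of a cyclic code form a retract of the code, by averaging over shifts. -/
theorem projective_constantIdeal {D : Submodule S (Fin n → S)} (hD : IsCyclicCode D)
    (hn : IsUnit (n : S)) [Module.Projective S D] : Module.Projective S (constantIdeal D) := by
  let incl : constantIdeal D →ₗ[S] D :=
    { toFun := fun a => ⟨fun _ => a.1, a.2⟩
      map_add' := fun _ _ => rfl
      map_smul' := fun _ _ => rfl }
  let average : D →ₗ[S] constantIdeal D :=
    { toFun := fun c => ⟨↑hn.unit⁻¹ * ∑ j, c.1 j,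
        Ideal.mul_mem_left _ _ (sum_mem_constantIdeal hD c.2)⟩
      map_add' := fun a b => by
        ext
        simp [Finset.sum_add_distrib, mul_add]
      map_smul' := fun r a => by
        ext
        simp [← Finset.mul_sum, mul_left_comm] }
  refine Module.Projective.of_split incl average (LinearMap.ext fun a => Subtype.ext ?_)
  have h : (↑hn.unit⁻¹ : S) * n = 1 := hn.val_inv_mul
  simp [incl, average, ← mul_assoc, h]

theorem not_isSelfDual_of_free_of_isCyclicCode [IsLocalRing S] [IsNoetherianRing S]
    (D : Submodule S (Fin n → S)) (hn : IsUnit (n : S)) (hD : IsCyclicCode D)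
    [Module.Free S D] : ¬ IsSelfDual D := by
  intro hdual
  have := projective_constantIdeal hD hn
  have hfree : Module.Free S (constantIdeal D) := Module.free_of_flat_of_isLocalRing
  let b := Module.Free.chooseBasis S (constantIdeal D)
  have hsq : ∀ a ∈ constantIdeal D, a * a = 0 := by
    intro a ha
    have ha' : (fun _ => a) ∈ dualCode D := hdual ▸ mem_constantIdeal.mp ha
    have h : ∑ _j : Fin n, a * a = 0 := ha' _ (mem_constantIdeal.mp ha)
    rw [Finset.sum_const, Finset.card_univ, Fintype.card_fin, nsmul_eq_mul] at h
    exact hn.mul_right_eq_zero.mp h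
  have hempty : IsEmpty (Module.Free.ChooseBasisIndex S (constantIdeal D)) := by
    refine ⟨fun i => ?_⟩
    -- the basis vector `b i` kills itself, so linear independence makes its value zero
    have h0 : (b i : S) • b i = 0 := Subtype.ext (hsq _ (b i).2)
    have h1 := congrArg (fun x => b.repr x i) h0
    have h2 : (b i : S) = 0 := by simpa using h1
    exact b.ne_zero i (Subtype.ext h2)
  have hzero : ∀ a ∈ constantIdeal D, a = 0 := fun a ha =>
    congrArg Subtype.val ((b.ext_elem fun i => hempty.elim i : (⟨a, ha⟩ : constantIdeal D) = 0))
  have hone : (fun _ => (1 : S)) ∈ dualCode D := fun v hv => by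
    simpa using hzero _ (sum_mem_constantIdeal hD hv)
  exact one_ne_zero (hzero 1 (mem_constantIdeal.mpr (hdual ▸ hone)))

end LocalRing

section ChineseRemainder

variable {R : Type*} [CommRing R]

theorem isUnit_natCast_of_coprime_residueCard [Finite R] (m : MaximalSpectrum R) {n : ℕ}
    (hn : n.Coprime (residueCard m)) : IsUnit (n : LocalComponent m) := by
  have : Finite (LocalComponent m) := Finite.of_surjective _ Ideal.Quotient.mk_surjective
  have : Finite (IsLocalRing.ResidueField (LocalComponent m)) :=
    Finite.of_surjective _ IsLocalRing.residue_surjective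
  have h : IsCoprime (n : IsLocalRing.ResidueField (LocalComponent m)) (residueCard m) := by
    simpa using (Nat.isCoprime_iff_coprime.mpr hn).map
      (Int.castRingHom (IsLocalRing.ResidueField (LocalComponent m)))
  have hq : (residueCard m : IsLocalRing.ResidueField (LocalComponent m)) = 0 := by
    have := Fintype.ofFinite (IsLocalRing.ResidueField (LocalComponent m))
    rw [residueCard, Nat.card_eq_fintype_card, Nat.cast_card_eq_zero]
  rw [hq, isCoprime_zero_right] at h
  refine (IsLocalRing.residue_ne_zero_iff_isUnit _).mp ?_
  rw [map_natCast]
  exact h.ne_zero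

variable {k : ℕ}

theorem pairwise_isCoprime_pow (m : Fin k ≃ MaximalSpectrum R) (t : Fin k → ℕ) :
    Pairwise fun i j => IsCoprime ((m i).asIdeal ^ t i) ((m j).asIdeal ^ t j) := fun _ _ hij =>
  IsCoprime.pow (Ideal.isCoprime_of_isMaximal fun h =>
    hij (m.injective (MaximalSpectrum.ext h)))

/-- The stable powers of the maximal ideals of a finite ring intersect in zero: their
intersection is contained in every power of the nilpotent Jacobson radical. -/
theorem eq_zero_of_forall_mem_pow_stabilityIndex [Finite R] (m : Fin k ≃ MaximalSpectrum R)
    {x : R} (hx : ∀ i, x ∈ (m i).asIdeal ^ stabilityIndex (m i).asIdeal) : x = 0 := by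
  obtain ⟨N, hN⟩ := IsArtinianRing.isNilpotent_jacobson_bot (R := R)
  have hx' : x ∈ ∏ i, (m i).asIdeal ^ N := by
    rw [Ideal.prod_eq_iInf_of_pairwise_isCoprime fun _ _ _ _ hij =>
      pairwise_isCoprime_pow m (fun _ => N) hij]
    simp only [Finset.mem_univ, iInf_pos, Ideal.mem_iInf]
    intro i
    have h := (stabilityIndex_mem (m i).asIdeal).2 (max N (stabilityIndex (m i).asIdeal))
      (le_max_right _ _)
    exact Ideal.pow_le_pow_right (le_max_left _ _) (h ▸ hx i)
  have hle : ∏ i, (m i).asIdeal ≤ Ideal.jacobson (⊥ : Ideal R) := by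
    refine le_sInf fun J hJ => ?_
    have h : (m (m.symm ⟨J, hJ.2⟩)).asIdeal = J := by rw [Equiv.apply_symm_apply]
    exact Ideal.prod_le_inf.trans ((Finset.inf_le (Finset.mem_univ _)).trans h.le)
  rw [Finset.prod_pow] at hx'
  have h := Ideal.pow_right_mono hle N hx'
  rwa [hN] at h

variable {n : ℕ} (m : Fin k ≃ MaximalSpectrum R)
  (D : ∀ i, Submodule (LocalComponent (m i)) (Fin n → LocalComponent (m i)))

/-- Every word over one component lifts to a word over `R` vanishing in all other components. -/
theorem exists_projection_eq (i : Fin k) (d : Fin n → LocalComponent (m i)) :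
    ∃ u : Fin n → R, projection (m i) u = d ∧ ∀ j ≠ i, projection (m j) u = 0 := by
  choose v hv using fun j => Ideal.Quotient.mk_surjective (d j)
  obtain ⟨e, he⟩ := Ideal.exists_forall_sub_mem_ideal
    (I := fun j => (m j).asIdeal ^ stabilityIndex (m j).asIdeal)
    (pairwise_isCoprime_pow m fun j => stabilityIndex (m j).asIdeal) (Pi.single i 1)
  refine ⟨fun j => e * v j, ?_, fun l hl => ?_⟩
  · have h := he i
    rw [Pi.single_eq_same] at h
    ext j
    simp only [projection, map_mul, hv, (Ideal.Quotient.mk_eq_mk_iff_sub_mem _ _).mpr h, map_one,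
      one_mul]
  · have h := he l
    rw [Pi.single_eq_of_ne hl] at h
    ext j
    simp only [projection, map_mul, (Ideal.Quotient.mk_eq_mk_iff_sub_mem _ _).mpr h, map_zero,
      zero_mul, Pi.zero_apply]

theorem exists_mem_chineseProduct (i : Fin k) {d : Fin n → LocalComponent (m i)} (hd : d ∈ D i) :
    ∃ u ∈ chineseProduct m D, projection (m i) u = d := by
  obtain ⟨u, hu, hu'⟩ := exists_projection_eq m i d
  refine ⟨u, fun j => ?_, hu⟩
  rcases eq_or_ne j i with rfl | hj
  · exact hu ▸ hd
  · rw [hu' j hj]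
    exact (D j).zero_mem

theorem chineseProduct_component_cyclic (h : IsCyclicCode (chineseProduct m D)) (i : Fin k) :
    IsCyclicCode (D i) := by
  intro d hd
  obtain ⟨u, hu, rfl⟩ := exists_mem_chineseProduct m D i hd
  exact h u hu i

theorem mk_sum_mul (i : Fin k) (u v : Fin n → R) :
    (Ideal.Quotient.mk _ (∑ j, u j * v j) : LocalComponent (m i)) =
      ∑ j, projection (m i) u j * projection (m i) v j := by
  simp [projection]

/-- For the inclusion of the dual of a component in that component, a word orthogonal to `D i` is
lifted with zeros in the other components, so that its products with codewords vanish modulo every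
stable power and hence in `R`. -/
theorem chineseProduct_component_isSelfDual [Finite R] (h : IsSelfDual (chineseProduct m D))
    (i : Fin k) : IsSelfDual (D i) := by
  refine le_antisymm (fun d hd v hv => ?_) fun d hd => ?_
  · obtain ⟨u, hu, rfl⟩ := exists_mem_chineseProduct m D i hd
    obtain ⟨w, hw, rfl⟩ := exists_mem_chineseProduct m D i hv
    have hu' : u ∈ dualCode (chineseProduct m D) := h ▸ hu
    rw [← mk_sum_mul, hu' w hw, map_zero]
  · obtain ⟨u, rfl, hu'⟩ := exists_projection_eq m i d
    have hu : u ∈ dualCode (chineseProduct m D) := fun v hv => by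
      refine eq_zero_of_forall_mem_pow_stabilityIndex m fun l =>
        Ideal.Quotient.eq_zero_iff_mem.mp ?_
      rw [mk_sum_mul]
      rcases eq_or_ne l i with rfl | hl
      · exact hd _ (hv l)
      · simp [hu' l hl]
    rw [← h] at hu
    exact hu i

end ChineseRemainder

end RingCode

/-- `m` enumerates the maximal ideals of `R` without repetition, and
`D i` is the `i`-th component of the code `C`. -/
theorem mainTheorem12 {R : Type*} [CommRing R] [Finite R] [IsPrincipalIdealRing R]
    {k : ℕ} (m : Fin k ≃ MaximalSpectrum R) (n : ℕ)
    (hn : ∀ i, Nat.Coprime n (RingCode.residueCard (m i)))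
    (D : ∀ i, Submodule (RingCode.LocalComponent (m i))
      (Fin n → RingCode.LocalComponent (m i)))
    (C : Submodule R (Fin n → R)) (hC : C = RingCode.chineseProduct m D)
    (hcyc : RingCode.IsCyclicCode C)
    (hfree : ∃ i, Odd (RingCode.residueCard (m i)) ∧
      Module.Free (RingCode.LocalComponent (m i)) (D i)) :
    ¬ RingCode.IsSelfDual C := by
  subst hC
  obtain ⟨i, -, hi⟩ := hfree
  exact fun h => RingCode.not_isSelfDual_of_free_of_isCyclicCode (D i)
    (RingCode.isUnit_natCast_of_coprime_residueCard (m i) (hn i))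
    (RingCode.chineseProduct_component_cyclic m D hcyc i)
    (RingCode.chineseProduct_component_isSelfDual m D h i)
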